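/- Let $\theta\in(0,\frac{\pi}{2})$ and let $$\widetilde\Omega_\theta=\Big\{(\tilde x,\tilde y)\in\big(-\tfrac{\pi}{\tan\theta},+\infty\big)\times(0,\pi)\;:\;\tilde y<\tilde x\tan\theta+\pi\ \text{ if }\ \tilde x\in\big(-\tfrac{\pi}{\tan\theta},0\big)\Big\}.$$ Let $\partial_{\mathsf{Dir}}\widetilde\Omega_\theta$ be the union of the horizontal parts of its boundary, $\{\tilde y=0,\ \tilde x\ge-\frac{\pi}{\tan\theta}\}\cup\{\tilde y=\pi,\ \tilde x\ge0\}$, and let $V=\{u\in H^1(\widetilde\Omega_\theta;\mathbb{C}) : u=0 \text{ on } \partial_{\mathsf{Dir}}\widetilde\Omega_\theta\}$, where the boundary condition means that $u$ is a limit in $H^1(\widetilde\Omega_\theta)$ of functions in $C_c^\infty(\mathbb{R}^2\setminus\partial_{\mathsf{Dir}}\widetilde\Omega_\theta)$. Let $\Delta^{\mathsf{Mix}}_{\widetilde\Omega_\theta}$ be the positive Laplacian with Dirichlet conditions on $\partial_{\mathsf{Dir}}\widetilde\Omega_\theta$ and Neumann conditions on the remaining (slanted) side, that is, the self-adjoint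 operator on $L^2(\widetilde\Omega_\theta)$ such that $u$ is in its domain and is mapped to $f\in L^2(\widetilde\Omega_\theta)$ if and only if $u\in V$ and $\int_{\widetilde\Omega_\theta}\nabla u\cdot\overline{\nabla v}=\int_{\widetilde\Omega_\theta} f\,\overline{v}$ for all $v\in V$. Let $\psi$ be an eigenvector of $\Delta^{\mathsf{Mix}}_{\widetilde\Omega_\theta}$ associated with an eigenvalue $\lambda<1$. Then for all $\varepsilon>0$ $$\int_0^\infty\int_0^\pi e^{2\tilde x(\sqrt{1-\lambda}-\varepsilon)}\left(|\psi(\tilde x,\tilde y)|^2+|\nabla\psi(\tilde x,\tilde y)|^2\right)\,d\tilde y\,d\tilde x<\infty .$$ -/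

import Mathlib

open MeasureTheory Set Filter Topology
open scoped ContDiff

/-- Classical partial derivative of `φ` at `p` in the first coordinate. -/
noncomputable def partialX (φ : ℝ × ℝ → ℂ) (p : ℝ × ℝ) : ℂ := fderiv ℝ φ p (1, 0)

/-- Classical partial derivative of `φ` at `p` in the second coordinate. -/
noncomputable def partialY (φ : ℝ × ℝ → ℂ) (p : ℝ × ℝ) : ℂ := fderiv ℝ φ p (0, 1)

/-- `(gx, gy)` is the weak (distributional) gradient of `u` on the open set `Ω`. -/
structure HasWeakGradient (Ω : Set (ℝ × ℝ)) (u gx gy : ℝ × ℝ → ℂ) : Prop where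
  locInt : LocallyIntegrableOn u Ω volume
  locInt_x : LocallyIntegrableOn gx Ω volume
  locInt_y : LocallyIntegrableOn gy Ω volume
  weak_x : ∀ φ : ℝ × ℝ → ℂ, ContDiff ℝ ∞ φ → HasCompactSupport φ → tsupport φ ⊆ Ω →
    ∫ p in Ω, u p * partialX φ p = -∫ p in Ω, gx p * φ p
  weak_y : ∀ φ : ℝ × ℝ → ℂ, ContDiff ℝ ∞ φ → HasCompactSupport φ → tsupport φ ⊆ Ω →
    ∫ p in Ω, u p * partialY φ p = -∫ p in Ω, gy p * φ p

/-- `u` belongs to the Sobolev space `H¹(Ω)`, and `(gx, gy)` is its weak gradient. -/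
structure MemH1 (Ω : Set (ℝ × ℝ)) (u gx gy : ℝ × ℝ → ℂ) : Prop where
  memLp : MemLp u 2 (volume.restrict Ω)
  memLp_x : MemLp gx 2 (volume.restrict Ω)
  memLp_y : MemLp gy 2 (volume.restrict Ω)
  weakGradient : HasWeakGradient Ω u gx gy

/-- `u` belongs to the form domain `V = {u ∈ H¹(Ω) : u = 0 on Γ}`, where `Γ` is a closed part of
the boundary of `Ω`, and `(gx, gy)` is the weak gradient of `u`.  The Dirichlet condition on `Γ` is
understood in the usual way: `u` is the limit in `H¹(Ω)` of smooth functions with compact support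
in `ℝ² ∖ Γ`, that is, of smooth functions with bounded support that vanish near `Γ` (and are not
constrained on the rest of the boundary). -/
structure MemFormDomain (Ω Γ : Set (ℝ × ℝ)) (u gx gy : ℝ × ℝ → ℂ) : Prop where
  memH1 : MemH1 Ω u gx gy
  approx : ∃ φ : ℕ → ℝ × ℝ → ℂ,
    (∀ n, ContDiff ℝ ∞ (φ n) ∧ HasCompactSupport (φ n) ∧ tsupport (φ n) ⊆ Γᶜ) ∧
    Tendsto (fun n => eLpNorm (u - φ n) 2 (volume.restrict Ω)) atTop (𝓝 0) ∧
    Tendsto (fun n => eLpNorm (gx - partialX (φ n)) 2 (volume.restrict Ω)) atTop (𝓝 0) ∧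
    Tendsto (fun n => eLpNorm (gy - partialY (φ n)) 2 (volume.restrict Ω)) atTop (𝓝 0)

/-- The graph of the positive Laplacian on `Ω` with Dirichlet condition on `Γ` and Neumann condition
on the rest of the boundary: the self-adjoint operator `A` on `L²(Ω)` associated with the form
`b(u, v) = ∫_Ω ∇u · conj ∇v` on `V = {u ∈ H¹(Ω) : u = 0 on Γ}`.  The proposition
`IsMixedLaplacian Ω Γ u f` says that `u ∈ Dom A` and `A u = f`, i.e. `u ∈ V`, `f ∈ L²(Ω)` and
`b(u, v) = ⟨f, v⟩` for all `v ∈ V`. -/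
def IsMixedLaplacian (Ω Γ : Set (ℝ × ℝ)) (u f : ℝ × ℝ → ℂ) : Prop :=
  ∃ gx gy : ℝ × ℝ → ℂ, MemFormDomain Ω Γ u gx gy ∧ MemLp f 2 (volume.restrict Ω) ∧
    ∀ v hx hy : ℝ × ℝ → ℂ, MemFormDomain Ω Γ v hx hy →
      ∫ p in Ω, (gx p * star (hx p) + gy p * star (hy p)) = ∫ p in Ω, f p * star (v p)

/-- The half-guide of opening `θ`: the part of the strip `0 < y < π` lying to the right of the
segment that joins `(-π / tan θ, 0)` to `(0, π)`. -/
def halfGuide (θ : ℝ) : Set (ℝ × ℝ) :=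
  {p | -Real.pi / Real.tan θ < p.1 ∧ 0 < p.2 ∧ p.2 < Real.pi ∧
    (p.1 < 0 → p.2 < p.1 * Real.tan θ + Real.pi)}

/-- The Dirichlet part of the boundary of the half-guide, namely its two horizontal half-lines. -/
def halfGuideDirichlet (θ : ℝ) : Set (ℝ × ℝ) :=
  {p | (p.2 = 0 ∧ -Real.pi / Real.tan θ ≤ p.1) ∨ (p.2 = Real.pi ∧ 0 ≤ p.1)}

/-- `ψ` is an eigenvector, for the eigenvalue `lam`, of the positive mixed Laplacian on the
half-guide (Dirichlet on the horizontal parts of the boundary, Neumann on the slanted segment). -/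
def IsMixedEigenvector (θ lam : ℝ) (ψ : ℝ × ℝ → ℂ) : Prop :=
  ¬ ψ =ᵐ[volume.restrict (halfGuide θ)] 0 ∧
    IsMixedLaplacian (halfGuide θ) (halfGuideDirichlet θ) ψ (fun p => (lam : ℂ) * ψ p)

/-! This is Agmon's method. Test the eigenvalue equation against `w² ψ`, where `w` depends on the
first coordinate and `|w'| ≤ a w`. Completing the square in the first derivative leaves `∫ w²|∂y ψ|²
≤ (λ + a²) ∫ w²|ψ|²` over the whole guide. On the right half-strip, Wirtinger's inequality on the
vertical segments, applied to `w ψ`, gives `∫ w²|ψ|² ≤ ∫ w²|∂y ψ|²`. When `a² < 1 - λ` the strip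
part is absorbed, and what remains lives on `x ≤ 0`, where `w ≤ 1`.

The test function must lie in the form domain, so `e^{ax}` is replaced by the bounded `expWeight a
δ`. The estimate (`MemFormDomain.integral_weighted_energy_le`) does not depend on `δ`, and Fatou's
lemma lets `δ → 0`. -/

/-- The bounded exponential weight `e ^ (a x) / (1 + δ e ^ (a x))`. -/
noncomputable def expWeight (a δ x : ℝ) : ℝ := Real.exp (a * x) / (1 + δ * Real.exp (a * x))

/-! ### Bounds and limit of the regularised weight. -/

section Weight
variable {a δ : ℝ}

theorem expWeight_pos (hδ : 0 < δ) (x : ℝ) : 0 < expWeight a δ x := by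
  unfold expWeight; positivity

theorem expWeight_le_exp (hδ : 0 < δ) (x : ℝ) : expWeight a δ x ≤ Real.exp (a * x) := by
  unfold expWeight
  exact div_le_self (Real.exp_pos _).le (by have := Real.exp_pos (a * x); nlinarith)

theorem expWeight_le_inv (hδ : 0 < δ) (x : ℝ) : expWeight a δ x ≤ δ⁻¹ := by
  unfold expWeight
  have := Real.exp_pos (a * x)
  rw [div_le_iff₀ (by positivity), mul_add, ← mul_assoc, inv_mul_cancel₀ hδ.ne']
  nlinarith [inv_pos.2 hδ]

theorem contDiff_expWeight (hδ : 0 < δ) : ContDiff ℝ ∞ (expWeight a δ) := by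
  unfold expWeight
  refine ContDiff.div (by fun_prop) (by fun_prop) fun x => ?_
  positivity

theorem hasDerivAt_expWeight (hδ : 0 < δ) (x : ℝ) :
    HasDerivAt (expWeight a δ) (a * Real.exp (a * x) / (1 + δ * Real.exp (a * x)) ^ 2) x := by
  have h : HasDerivAt (fun y => Real.exp (a * y)) (Real.exp (a * x) * a) x := by
    simpa using ((hasDerivAt_id x).const_mul a).exp
  have hp : 1 + δ * Real.exp (a * x) ≠ 0 := by positivity
  refine (h.div ((h.const_mul δ).const_add 1) hp).congr_deriv ?_
  congr 1
  ring

/-- The logarithmic derivative is `a / (1 + δ e^{ax})`, hence at most `a` for every `δ`; this makes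
the Agmon estimate uniform in `δ`. -/
theorem abs_deriv_expWeight_le (ha : 0 ≤ a) (hδ : 0 < δ) (x : ℝ) :
    |deriv (expWeight a δ) x| ≤ a * expWeight a δ x := by
  rw [(hasDerivAt_expWeight hδ x).deriv, abs_of_nonneg (by positivity), expWeight,
    ← mul_div_assoc]
  have := Real.exp_pos (a * x)
  refine div_le_div_of_nonneg_left (by positivity) (by positivity) ?_
  have : 0 < δ * Real.exp (a * x) := by positivity
  nlinarith

theorem tendsto_expWeight (x : ℝ) :
    Tendsto (fun n : ℕ => expWeight a (1 / ((n : ℝ) + 1)) x) atTop (𝓝 (Real.exp (a * x))) := by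
  unfold expWeight
  have h := (tendsto_one_div_add_atTop_nhds_zero_nat (𝕜 := ℝ)).mul_const (Real.exp (a * x))
  have h2 := (tendsto_const_nhds (x := Real.exp (a * x))).div (h.const_add 1) (by simp)
  simpa [Pi.div_def] using h2

end Weight

/-! ### Transverse Wirtinger inequality. -/

/-- Wirtinger's inequality with Dirichlet conditions on `(0, π)`. -/
theorem integral_norm_sq_le_integral_norm_deriv_sq {f f' : ℝ → ℂ}
    (hf : ∀ y, HasDerivAt f (f' y) y) (hf' : Continuous f') (h0 : f 0 = 0) (hπ : f Real.pi = 0) :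
    ∫ y in (0 : ℝ)..Real.pi, ‖f y‖ ^ 2 ≤ ∫ y in (0 : ℝ)..Real.pi, ‖f' y‖ ^ 2 := by
  have hc : Continuous f := continuous_iff_continuousAt.2 fun y => (hf y).continuousAt
  -- For `k < 1` the tangent below has no pole on `[0, π]`, endpoints included; `k → 1` is taken at
  -- the end.
  have key : ∀ k ∈ Ioo (0 : ℝ) 1,
      k ^ 2 * ∫ y in (0 : ℝ)..Real.pi, ‖f y‖ ^ 2 ≤ ∫ y in (0 : ℝ)..Real.pi, ‖f' y‖ ^ 2 := by
    intro k hk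
    have hcos : ∀ y ∈ uIcc 0 Real.pi, 0 < Real.cos (k * (y - Real.pi / 2)) := by
      intro y hy
      rw [uIcc_of_le Real.pi_pos.le] at hy
      have := Real.pi_pos
      apply Real.cos_pos_of_mem_Ioo
      constructor <;> nlinarith [hk.1, hk.2, hy.1, hy.2]
    -- A solution of the Riccati equation `c' = k² + c²`. Then `‖f'‖² + (‖f‖² c)' - k²‖f‖²`
    -- dominates the square `(‖f'‖ - |c|‖f‖)²`, and the total derivative integrates to zero by the
    -- boundary values.
    set c : ℝ → ℝ := fun y => k * Real.tan (k * (y - Real.pi / 2)) with hcdef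
    have hder : ∀ y ∈ uIcc 0 Real.pi,
        HasDerivAt c (k ^ 2 + c y ^ 2) y := by
      intro y hy
      have h1 : HasDerivAt (fun y => k * (y - Real.pi / 2)) k y := by
        simpa using ((hasDerivAt_id y).sub_const (Real.pi / 2)).const_mul k
      have h2 := ((Real.hasDerivAt_tan (hcos y hy).ne').comp y h1).const_mul k
      refine h2.congr_deriv ?_
      have := (hcos y hy).ne'
      have h3 := Real.sin_sq_add_cos_sq (k * (y - Real.pi / 2))
      simp only [hcdef, Real.tan_eq_sin_div_cos]
      rw [mul_pow, div_pow, eq_sub_of_add_eq h3]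
      generalize Real.cos (k * (y - Real.pi / 2)) = t at this
      field_simp
      ring
    have hcc : ContinuousOn c (uIcc 0 Real.pi) := fun y hy =>
      (hder y hy).continuousAt.continuousWithinAt
    have hF : ∀ y ∈ uIcc 0 Real.pi, HasDerivAt (fun y => ‖f y‖ ^ 2 * c y)
        (2 * inner ℝ (f y) (f' y) * c y + ‖f y‖ ^ 2 * (k ^ 2 + c y ^ 2)) y := fun y hy =>
      ((hf y).norm_sq).mul (hder y hy)
    have hcont : ContinuousOn
        (fun y => 2 * inner ℝ (f y) (f' y) * c y + ‖f y‖ ^ 2 * (k ^ 2 + c y ^ 2))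
        (uIcc 0 Real.pi) := by fun_prop
    have hint := intervalIntegral.integral_eq_sub_of_hasDerivAt hF hcont.intervalIntegrable
    simp only [h0, hπ, norm_zero] at hint
    have hif : IntervalIntegrable (fun y => k ^ 2 * ‖f y‖ ^ 2) volume 0 Real.pi :=
      Continuous.intervalIntegrable (by fun_prop) _ _
    have hif' : IntervalIntegrable (fun y => ‖f' y‖ ^ 2) volume 0 Real.pi :=
      Continuous.intervalIntegrable (by fun_prop) _ _
    rw [← intervalIntegral.integral_const_mul]
    have h : ∫ y in (0 : ℝ)..Real.pi, k ^ 2 * ‖f y‖ ^ 2 ≤ ∫ y in (0 : ℝ)..Real.pi,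
        (‖f' y‖ ^ 2 + (2 * inner ℝ (f y) (f' y) * c y + ‖f y‖ ^ 2 * (k ^ 2 + c y ^ 2))) := by
      refine intervalIntegral.integral_mono_on Real.pi_pos.le hif
        (hif'.add hcont.intervalIntegrable) fun y _ => ?_
      have h1 : |inner ℝ (f y) (f' y)| ≤ ‖f y‖ * ‖f' y‖ := abs_real_inner_le_norm _ _
      have h2 : |c y * inner ℝ (f y) (f' y)| ≤ |c y| * (‖f y‖ * ‖f' y‖) := by
        rw [abs_mul]; gcongr
      have h3 := neg_le_of_abs_le h2
      nlinarith [sq_nonneg (‖f' y‖ - |c y| * ‖f y‖), sq_abs (c y)]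
    rw [intervalIntegral.integral_add hif' hcont.intervalIntegrable, hint] at h
    simpa using h
  have ht : Tendsto (fun k : ℝ => k ^ 2 * ∫ y in (0 : ℝ)..Real.pi, ‖f y‖ ^ 2) (𝓝[<] 1)
      (𝓝 (∫ y in (0 : ℝ)..Real.pi, ‖f y‖ ^ 2)) := by
    have : Continuous (fun k : ℝ => k ^ 2 * ∫ y in (0 : ℝ)..Real.pi, ‖f y‖ ^ 2) := by fun_prop
    simpa using (this.tendsto 1).mono_left nhdsWithin_le_nhds
  exact le_of_tendsto ht (by
    filter_upwards [Ioo_mem_nhdsLT (zero_lt_one' ℝ)] with k hk using key k hk)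

/-! ### Multiplication by a function of the first coordinate. -/

section ProductRule
variable {g : ℝ → ℝ} {φ : ℝ × ℝ → ℂ}

theorem contDiff_ofReal_comp_fst_mul (hg : ContDiff ℝ ∞ g) (hφ : ContDiff ℝ ∞ φ) :
    ContDiff ℝ ∞ fun p : ℝ × ℝ => (g p.1 : ℂ) * φ p :=
  (Complex.ofRealCLM.contDiff.comp (hg.comp contDiff_fst)).mul hφ

theorem fderiv_ofReal_comp_fst_mul (hg : ContDiff ℝ ∞ g) (hφ : ContDiff ℝ ∞ φ) (p v : ℝ × ℝ) :
    fderiv ℝ (fun p : ℝ × ℝ => (g p.1 : ℂ) * φ p) p v =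
      g p.1 * fderiv ℝ φ p v + v.1 * (deriv g p.1 : ℝ) * φ p := by
  have h1 : HasDerivAt (fun x => (g x : ℂ)) ((deriv g p.1 : ℝ) : ℂ) p.1 :=
    ((hg.differentiable (by simp)) p.1).hasDerivAt.ofReal_comp
  have h2 := h1.hasFDerivAt.comp p (hasFDerivAt_fst (𝕜 := ℝ) (p := p))
  have h3 := h2.mul ((hφ.differentiable (by simp)) p).hasFDerivAt
  have h4 : fderiv ℝ (fun p : ℝ × ℝ => (g p.1 : ℂ) * φ p) p = _ := h3.fderiv
  rw [h4]
  simp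
  ring

theorem partialX_ofReal_comp_fst_mul (hg : ContDiff ℝ ∞ g) (hφ : ContDiff ℝ ∞ φ) (p : ℝ × ℝ) :
    partialX (fun p : ℝ × ℝ => (g p.1 : ℂ) * φ p) p =
      g p.1 * partialX φ p + (deriv g p.1 : ℝ) * φ p := by
  simp [partialX, fderiv_ofReal_comp_fst_mul hg hφ]

theorem partialY_ofReal_comp_fst_mul (hg : ContDiff ℝ ∞ g) (hφ : ContDiff ℝ ∞ φ) (p : ℝ × ℝ) :
    partialY (fun p : ℝ × ℝ => (g p.1 : ℂ) * φ p) p = g p.1 * partialY φ p := by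
  simp [partialY, fderiv_ofReal_comp_fst_mul hg hφ]

theorem continuous_partialX (hφ : ContDiff ℝ ∞ φ) : Continuous (partialX φ) :=
  (hφ.continuous_fderiv (by simp)).clm_apply continuous_const

theorem continuous_partialY (hφ : ContDiff ℝ ∞ φ) : Continuous (partialY φ) :=
  (hφ.continuous_fderiv (by simp)).clm_apply continuous_const

theorem hasCompactSupport_partialX (hφ : HasCompactSupport φ) : HasCompactSupport (partialX φ) :=
  hφ.fderiv_apply ℝ (1, 0)

theorem hasCompactSupport_partialY (hφ : HasCompactSupport φ) : HasCompactSupport (partialY φ) :=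
  hφ.fderiv_apply ℝ (0, 1)

end ProductRule

/-- Moves the Poincaré inequality to seminorms, where the triangle inequality carries it through an
`L²` limit. -/
theorem eLpNorm_two_le_iff_integral_norm_sq_le {α E : Type*} [MeasurableSpace α]
    [NormedAddCommGroup E] {μ : Measure α} {f g : α → E} (hf : MemLp f 2 μ) (hg : MemLp g 2 μ) :
    eLpNorm f 2 μ ≤ eLpNorm g 2 μ ↔ ∫ x, ‖f x‖ ^ 2 ∂μ ≤ ∫ x, ‖g x‖ ^ 2 ∂μ := by
  rw [hf.eLpNorm_eq_integral_rpow_norm (by simp) (by simp),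
    hg.eLpNorm_eq_integral_rpow_norm (by simp) (by simp),
    ENNReal.ofReal_le_ofReal_iff (by positivity)]
  simp only [ENNReal.toReal_ofNat, Real.rpow_ofNat]
  exact Real.rpow_le_rpow_iff (by positivity) (by positivity) (by norm_num)

section Weighted
variable {μ : Measure (ℝ × ℝ)} {g : ℝ → ℝ} {C : ℝ} {u : ℝ × ℝ → ℂ}

theorem norm_ofReal_comp_fst_mul_le (hC : ∀ x, |g x| ≤ C) (p : ℝ × ℝ) :
    ‖(g p.1 : ℂ) * u p‖ ≤ C * ‖u p‖ := by
  rw [norm_mul, Complex.norm_real]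
  gcongr
  exact hC _

theorem aestronglyMeasurable_ofReal_comp_fst_mul (hg : Continuous g)
    (hu : AEStronglyMeasurable u μ) :
    AEStronglyMeasurable (fun p => (g p.1 : ℂ) * u p) μ :=
  (by fun_prop : Continuous fun p : ℝ × ℝ => (g p.1 : ℂ)).aestronglyMeasurable.mul hu

theorem MeasureTheory.MemLp.ofReal_comp_fst_mul (hg : Continuous g) (hC : ∀ x, |g x| ≤ C)
    (hu : MemLp u 2 μ) : MemLp (fun p => (g p.1 : ℂ) * u p) 2 μ :=
  hu.of_le_mul (aestronglyMeasurable_ofReal_comp_fst_mul hg hu.1)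
    (.of_forall (norm_ofReal_comp_fst_mul_le hC))

theorem tendsto_eLpNorm_ofReal_comp_fst_mul (hC : ∀ x, |g x| ≤ C) {v : ℕ → ℝ × ℝ → ℂ}
    (hv : Tendsto (fun n => eLpNorm (v n) 2 μ) atTop (𝓝 0)) :
    Tendsto (fun n => eLpNorm (fun p => (g p.1 : ℂ) * v n p) 2 μ) atTop (𝓝 0) := by
  have h := ENNReal.Tendsto.const_mul hv (.inr (ENNReal.ofReal_ne_top (r := C)))
  rw [mul_zero] at h
  exact tendsto_of_tendsto_of_tendsto_of_le_of_le tendsto_const_nhds h (fun _ => zero_le)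
    fun n => eLpNorm_le_mul_eLpNorm_of_ae_le_mul (.of_forall (norm_ofReal_comp_fst_mul_le hC)) 2

end Weighted

/-! ### Stability of the form domain and uniqueness of weak gradients. -/

section FormDomain
variable {Ω Γ : Set (ℝ × ℝ)} {u ux uy φ : ℝ × ℝ → ℂ} {g : ℝ → ℝ} {C C' : ℝ}

theorem tsupport_ofReal_comp_fst_mul_subset :
    tsupport (fun p : ℝ × ℝ => (g p.1 : ℂ) * φ p) ⊆ tsupport φ :=
  closure_mono fun p hp => by
    simp only [Function.mem_support] at hp ⊢
    exact right_ne_zero_of_mul hp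

/-- Square-integrable functions multiply with continuous compactly supported ones to
integrable functions. -/
theorem MeasureTheory.MemLp.integrable_mul_of_hasCompactSupport {μ : Measure (ℝ × ℝ)}
    [IsFiniteMeasureOnCompacts μ] (hu : MemLp u 2 μ) (hφ : Continuous φ)
    (hφ' : HasCompactSupport φ) : Integrable (fun p => u p * φ p) μ :=
  MemLp.integrable_mul (q := 2) hu (hφ.memLp_of_hasCompactSupport hφ')

/-- The factor `g` is moved onto the test function: `g φ` is again admissible, and its product rule
yields the term `g' u`. -/
theorem MemH1.ofReal_comp_fst_mul (hg : ContDiff ℝ ∞ g) (hC : ∀ x, |g x| ≤ C)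
    (hC' : ∀ x, |deriv g x| ≤ C') (h : MemH1 Ω u ux uy) :
    MemH1 Ω (fun p => (g p.1 : ℂ) * u p)
      (fun p => (g p.1 : ℂ) * ux p + ((deriv g p.1 : ℝ) : ℂ) * u p)
      (fun p => (g p.1 : ℂ) * uy p) := by
  have hg' : Continuous (deriv g) := hg.continuous_deriv (by simp)
  have m0 := h.memLp.ofReal_comp_fst_mul hg.continuous hC
  have m0' := h.memLp.ofReal_comp_fst_mul hg' hC'
  have mx := h.memLp_x.ofReal_comp_fst_mul hg.continuous hC
  have my := h.memLp_y.ofReal_comp_fst_mul hg.continuous hC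
  have loc : ∀ {f : ℝ × ℝ → ℂ}, MemLp f 2 (volume.restrict Ω) → LocallyIntegrableOn f Ω volume :=
    fun hf => locallyIntegrableOn_of_locallyIntegrable_restrict
      (hf.locallyIntegrable (by norm_num))
  refine ⟨m0, mx.add m0', my, loc m0, loc (mx.add m0'), loc my, fun φ hφ hφc hφΩ => ?_,
    fun φ hφ hφc hφΩ => ?_⟩
  · have hw := h.weakGradient.weak_x (fun p => (g p.1 : ℂ) * φ p)
      (contDiff_ofReal_comp_fst_mul hg hφ) hφc.mul_left
      (tsupport_ofReal_comp_fst_mul_subset.trans hφΩ)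
    have i1 := m0.integrable_mul_of_hasCompactSupport (continuous_partialX hφ)
      (hasCompactSupport_partialX hφc)
    have i2 := m0'.integrable_mul_of_hasCompactSupport hφ.continuous hφc
    have i3 := mx.integrable_mul_of_hasCompactSupport hφ.continuous hφc
    have e1 : ∫ p in Ω, u p * partialX (fun p => (g p.1 : ℂ) * φ p) p =
        (∫ p in Ω, (g p.1 : ℂ) * u p * partialX φ p) +
          ∫ p in Ω, ((deriv g p.1 : ℝ) : ℂ) * u p * φ p := by
      rw [← integral_add i1 i2]
      refine integral_congr_ae (.of_forall fun p => ?_)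
      simp only [partialX_ofReal_comp_fst_mul hg hφ]
      ring
    have e2 : ∫ p in Ω, ux p * ((g p.1 : ℂ) * φ p) = ∫ p in Ω, (g p.1 : ℂ) * ux p * φ p :=
      integral_congr_ae (.of_forall fun p => by simp only; ring)
    simp only [add_mul]
    rw [integral_add i3 i2, neg_add, ← e2, ← hw, e1]
    ring
  · have hw := h.weakGradient.weak_y (fun p => (g p.1 : ℂ) * φ p)
      (contDiff_ofReal_comp_fst_mul hg hφ) hφc.mul_left
      (tsupport_ofReal_comp_fst_mul_subset.trans hφΩ)
    simp only [partialY_ofReal_comp_fst_mul hg hφ] at hw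
    convert hw using 2
    · ext p; ring
    · congr 1; ext p; ring

/-- The form domain is stable under multiplication by a smooth bounded function of the first
coordinate with bounded derivative. -/
theorem MemFormDomain.ofReal_comp_fst_mul (hg : ContDiff ℝ ∞ g) (hC : ∀ x, |g x| ≤ C)
    (hC' : ∀ x, |deriv g x| ≤ C') (h : MemFormDomain Ω Γ u ux uy) :
    MemFormDomain Ω Γ (fun p => (g p.1 : ℂ) * u p)
      (fun p => (g p.1 : ℂ) * ux p + ((deriv g p.1 : ℝ) : ℂ) * u p)
      (fun p => (g p.1 : ℂ) * uy p) := by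
  refine ⟨h.memH1.ofReal_comp_fst_mul hg hC hC', ?_⟩
  obtain ⟨φ, hφ, h0, hx, hy⟩ := h.approx
  have hg' : Continuous (deriv g) := hg.continuous_deriv (by simp)
  -- Multiplication by `g` does not enlarge supports, so the approximants still vanish near `Γ`.
  refine ⟨fun n p => (g p.1 : ℂ) * φ n p, fun n => ⟨contDiff_ofReal_comp_fst_mul hg (hφ n).1,
    (hφ n).2.1.mul_left, tsupport_ofReal_comp_fst_mul_subset.trans (hφ n).2.2⟩, ?_, ?_, ?_⟩
  · refine (tendsto_eLpNorm_ofReal_comp_fst_mul hC h0).congr fun n => ?_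
    congr 1; ext p; simp only [Pi.sub_apply]; ring
  · have t := (tendsto_eLpNorm_ofReal_comp_fst_mul hC hx).add
      (tendsto_eLpNorm_ofReal_comp_fst_mul hC' h0)
    rw [add_zero] at t
    refine tendsto_of_tendsto_of_tendsto_of_le_of_le tendsto_const_nhds t (fun _ => zero_le)
      fun n => ?_
    have e : (fun p => (g p.1 : ℂ) * ux p + ((deriv g p.1 : ℝ) : ℂ) * u p) -
        partialX (fun p => (g p.1 : ℂ) * φ n p) =
        (fun p => (g p.1 : ℂ) * (ux - partialX (φ n)) p) +
          fun p => ((deriv g p.1 : ℝ) : ℂ) * (u - φ n) p := by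
      ext p
      simp only [Pi.sub_apply, Pi.add_apply, partialX_ofReal_comp_fst_mul hg (hφ n).1]
      ring
    simp only [e]
    exact eLpNorm_add_le
      (aestronglyMeasurable_ofReal_comp_fst_mul hg.continuous
        (h.memH1.memLp_x.1.sub (continuous_partialX (hφ n).1).aestronglyMeasurable))
      (aestronglyMeasurable_ofReal_comp_fst_mul hg'
        (h.memH1.memLp.1.sub (hφ n).1.continuous.aestronglyMeasurable)) (by norm_num)
  · refine (tendsto_eLpNorm_ofReal_comp_fst_mul hC hy).congr fun n => ?_
    congr 1; ext p
    simp only [Pi.sub_apply, partialY_ofReal_comp_fst_mul hg (hφ n).1]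
    ring

/-- The fundamental lemma of the calculus of variations on an open set, in the form of uniqueness
of the distributional density. -/
theorem ae_eq_of_setIntegral_mul_eq {v w : ℝ × ℝ → ℂ} (hΩ : IsOpen Ω)
    (hv : LocallyIntegrableOn v Ω volume) (hw : LocallyIntegrableOn w Ω volume)
    (h : ∀ φ : ℝ × ℝ → ℂ, ContDiff ℝ ∞ φ → HasCompactSupport φ → tsupport φ ⊆ Ω →
      ∫ p in Ω, v p * φ p = ∫ p in Ω, w p * φ p) :
    v =ᵐ[volume.restrict Ω] w := by
  -- This criterion uses real test functions and integrals over the whole plane: `g` is cast to `ℂ`,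
  -- and its support in `Ω` makes the two kinds of integral agree.
  have key := hΩ.ae_eq_zero_of_integral_contDiff_smul_eq_zero (hv.sub hw)
    fun g hg hgc hgΩ => by
    have hφ : ContDiff ℝ ∞ fun p => (g p : ℂ) := Complex.ofRealCLM.contDiff.comp hg
    have hφc : HasCompactSupport fun p => (g p : ℂ) := hgc.comp_left Complex.ofReal_zero
    have hsub : tsupport (fun p => (g p : ℂ)) ⊆ tsupport g :=
      closure_mono fun p hp => by simpa using hp
    have hi : ∀ {f : ℝ × ℝ → ℂ}, LocallyIntegrableOn f Ω volume →
        Integrable (fun p => f p * (g p : ℂ)) volume := fun {f} hf => by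
      have h1 := (hf.integrableOn_compact_subset hgΩ hgc).mul_continuousOn
        hφ.continuous.continuousOn hgc
      refine (integrableOn_iff_integrable_of_support_subset fun p hp => ?_).1 h1
      refine subset_tsupport g ?_
      simpa using right_ne_zero_of_mul hp
    have hres : ∀ f : ℝ × ℝ → ℂ, ∫ p in Ω, f p * (g p : ℂ) = ∫ p, f p * (g p : ℂ) := fun f =>
      setIntegral_eq_integral_of_forall_compl_eq_zero fun p hp => by
        rw [image_eq_zero_of_notMem_tsupport fun h => hp (hgΩ h)]; simp
    have := h _ hφ hφc (hsub.trans hgΩ)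
    rw [hres, hres] at this
    calc ∫ p, g p • (v - w) p = ∫ p, (v p * (g p : ℂ) - w p * (g p : ℂ)) :=
          integral_congr_ae (.of_forall fun p => by
            simp only [Complex.real_smul, Pi.sub_apply]; ring)
      _ = 0 := by rw [integral_sub (hi hv) (hi hw), this, sub_self]
  rw [Filter.EventuallyEq, ae_restrict_iff' hΩ.measurableSet]
  filter_upwards [key] with p hp hpΩ using sub_eq_zero.1 (hp hpΩ)

/-- Needed because `IsMixedLaplacian` supplies its own gradient, while the final theorem speaks of
an arbitrary weak gradient. -/
theorem HasWeakGradient.ae_eq {vx vy : ℝ × ℝ → ℂ} (hΩ : IsOpen Ω)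
    (h : HasWeakGradient Ω u ux uy) (h' : HasWeakGradient Ω u vx vy) :
    ux =ᵐ[volume.restrict Ω] vx ∧ uy =ᵐ[volume.restrict Ω] vy :=
  ⟨ae_eq_of_setIntegral_mul_eq hΩ h.locInt_x h'.locInt_x fun φ h1 h2 h3 =>
    neg_injective ((h.weak_x φ h1 h2 h3).symm.trans (h'.weak_x φ h1 h2 h3)),
  ae_eq_of_setIntegral_mul_eq hΩ h.locInt_y h'.locInt_y fun φ h1 h2 h3 =>
    neg_injective ((h.weak_y φ h1 h2 h3).symm.trans (h'.weak_y φ h1 h2 h3))⟩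

end FormDomain

/-! ### Poincaré inequality on the half-strip. -/

section Strip

theorem integral_strip_norm_sq_le {φ : ℝ × ℝ → ℂ} (hφ : ContDiff ℝ ∞ φ)
    (hφc : HasCompactSupport φ) (h0 : ∀ x > 0, φ (x, 0) = 0) (hπ : ∀ x > 0, φ (x, Real.pi) = 0) :
    ∫ p in Ioi 0 ×ˢ Ioo 0 Real.pi, ‖φ p‖ ^ 2 ≤
      ∫ p in Ioi 0 ×ˢ Ioo 0 Real.pi, ‖partialY φ p‖ ^ 2 := by
  have i1 : Integrable (fun p => ‖φ p‖ ^ 2) volume :=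
    (hφ.continuous.memLp_of_hasCompactSupport hφc).integrable_norm_pow (by simp)
  have i2 : Integrable (fun p => ‖partialY φ p‖ ^ 2) volume :=
    ((continuous_partialY hφ).memLp_of_hasCompactSupport
      (hasCompactSupport_partialY hφc)).integrable_norm_pow (by simp)
  rw [Measure.volume_eq_prod] at i1 i2 ⊢
  rw [setIntegral_prod _ i1.integrableOn, setIntegral_prod _ i2.integrableOn]
  have j : ∀ {F : ℝ × ℝ → ℝ}, Integrable F (volume.prod volume) →
      IntegrableOn (fun x => ∫ y in Ioo 0 Real.pi, F (x, y)) (Ioi 0) := fun {F} hF => by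
    have h := hF.integrableOn (s := Ioi (0 : ℝ) ×ˢ Ioo 0 Real.pi)
    rw [IntegrableOn, ← Measure.prod_restrict] at h
    exact h.integral_prod_left
  refine setIntegral_mono_on (j i1) (j i2) measurableSet_Ioi fun x hx => ?_
  simp only [← integral_Ioc_eq_integral_Ioo, ← intervalIntegral.integral_of_le Real.pi_pos.le]
  refine integral_norm_sq_le_integral_norm_deriv_sq (f := fun y => φ (x, y))
    (f' := fun y => partialY φ (x, y)) (fun y => ?_) ?_ (h0 x hx) (hπ x hx)
  · exact ((hφ.differentiable (by simp)) (x, y)).hasFDerivAt.comp_hasDerivAt y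
      ((hasDerivAt_const y x).prodMk (hasDerivAt_id y))
  · exact (continuous_partialY hφ).comp (by fun_prop)

/-- By density: the smooth approximants vanish pointwise on `Γ`, so Fubini and Wirtinger apply to
them, and convergence on `Ω` restricts to the strip. -/
theorem MemFormDomain.integral_strip_norm_sq_le {Ω Γ : Set (ℝ × ℝ)} {u ux uy : ℝ × ℝ → ℂ}
    (h : MemFormDomain Ω Γ u ux uy) (hΩ : Ioi 0 ×ˢ Ioo 0 Real.pi ⊆ Ω)
    (h0 : ∀ x > 0, (x, 0) ∈ Γ) (hπ : ∀ x > 0, (x, Real.pi) ∈ Γ) :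
    ∫ p in Ioi 0 ×ˢ Ioo 0 Real.pi, ‖u p‖ ^ 2 ≤
      ∫ p in Ioi 0 ×ˢ Ioo 0 Real.pi, ‖uy p‖ ^ 2 := by
  obtain ⟨φ, hφ, t0, -, ty⟩ := h.approx
  set μ := (volume : Measure (ℝ × ℝ)).restrict (Ioi 0 ×ˢ Ioo 0 Real.pi)
  have hμ : μ ≤ volume.restrict Ω := Measure.restrict_mono hΩ le_rfl
  have mu := h.memH1.memLp.mono_measure hμ
  have my := h.memH1.memLp_y.mono_measure hμ
  have s0 : Tendsto (fun n => eLpNorm (u - φ n) 2 μ) atTop (𝓝 0) :=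
    tendsto_of_tendsto_of_tendsto_of_le_of_le tendsto_const_nhds t0 (fun _ => zero_le)
      fun n => eLpNorm_mono_measure _ hμ
  have sy : Tendsto (fun n => eLpNorm (uy - partialY (φ n)) 2 μ) atTop (𝓝 0) :=
    tendsto_of_tendsto_of_tendsto_of_le_of_le tendsto_const_nhds ty (fun _ => zero_le)
      fun n => eLpNorm_mono_measure _ hμ
  rw [← eLpNorm_two_le_iff_integral_norm_sq_le mu my]
  have t := (s0.add sy).add_const (eLpNorm uy 2 μ)
  rw [add_zero, zero_add] at t
  refine ge_of_tendsto' t fun n => ?_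
  have mφ : MemLp (φ n) 2 μ := (hφ n).1.continuous.memLp_of_hasCompactSupport (hφ n).2.1
  have mφy : MemLp (partialY (φ n)) 2 μ := (continuous_partialY (hφ n).1).memLp_of_hasCompactSupport
    (hasCompactSupport_partialY (hφ n).2.1)
  have van : ∀ p ∈ Γ, φ n p = 0 := fun p hp =>
    image_eq_zero_of_notMem_tsupport fun hp' => (hφ n).2.2 hp' hp
  have key : eLpNorm (φ n) 2 μ ≤ eLpNorm (partialY (φ n)) 2 μ :=
    (eLpNorm_two_le_iff_integral_norm_sq_le mφ mφy).2
      (_root_.integral_strip_norm_sq_le (hφ n).1 (hφ n).2.1 (fun x hx => van _ (h0 x hx))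
        fun x hx => van _ (hπ x hx))
  calc eLpNorm u 2 μ = eLpNorm ((u - φ n) + φ n) 2 μ := by simp
    _ ≤ eLpNorm (u - φ n) 2 μ + eLpNorm (φ n) 2 μ :=
      eLpNorm_add_le (mu.sub mφ).1 mφ.1 (by norm_num)
    _ ≤ eLpNorm (u - φ n) 2 μ + eLpNorm (partialY (φ n)) 2 μ := by gcongr
    _ = eLpNorm (u - φ n) 2 μ + eLpNorm (uy - (uy - partialY (φ n))) 2 μ := by simp
    _ ≤ eLpNorm (u - φ n) 2 μ +
        (eLpNorm uy 2 μ + eLpNorm (uy - partialY (φ n)) 2 μ) := by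
      gcongr
      exact eLpNorm_sub_le my.1 (my.sub mφy).1 (by norm_num)
    _ = _ := by ring

end Strip

/-- Fatou's lemma, used to remove the regularisation of the weight. -/
theorem integrable_of_tendsto_of_integral_le {α : Type*} [MeasurableSpace α] {μ : Measure α}
    {F : ℕ → α → ℝ} {f : α → ℝ} {C : ℝ} (hF : ∀ n, Integrable (F n) μ) (h0 : ∀ n x, 0 ≤ F n x)
    (hC : ∀ n, ∫ x, F n x ∂μ ≤ C) (h : ∀ x, Tendsto (fun n => F n x) atTop (𝓝 (f x))) :
    Integrable f μ := by
  refine ⟨aestronglyMeasurable_of_tendsto_ae atTop (fun n => (hF n).1) (.of_forall h), ?_⟩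
  have h1 : ∫⁻ x, ‖f x‖ₑ ∂μ ≤ liminf (fun n => ∫⁻ x, ‖F n x‖ₑ ∂μ) atTop := by
    simp only [← (h _).enorm.liminf_eq]
    exact lintegral_liminf_le' fun n => (hF n).1.aemeasurable.enorm
  refine (h1.trans (liminf_le_of_le (by isBoundedDefault) fun b hb => ?_)).trans_lt
    (ENNReal.ofReal_lt_top (r := C))
  obtain ⟨n, hn⟩ := hb.exists
  refine hn.trans ?_
  rw [← ofReal_integral_norm_eq_lintegral_enorm (hF n)]
  refine ENNReal.ofReal_le_ofReal ((integral_congr_ae (.of_forall fun x => ?_)).trans_le (hC n))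
  exact Real.norm_of_nonneg (h0 n x)

/-! ### The weighted energy identity and Agmon's estimate. -/

section Energy
variable {Ω Γ : Set (ℝ × ℝ)} {u ux uy : ℝ × ℝ → ℂ} {w : ℝ → ℝ} {lam a C : ℝ}

theorem norm_ofReal_mul_sq (r : ℝ) (z : ℂ) : ‖(r : ℂ) * z‖ ^ 2 = r ^ 2 * ‖z‖ ^ 2 := by
  rw [norm_mul, Complex.norm_real, mul_pow, Real.norm_eq_abs, sq_abs]

theorem MeasureTheory.MemLp.integrable_sq_mul_norm_sq {μ : Measure (ℝ × ℝ)} (hw : Continuous w)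
    (hC : ∀ x, |w x| ≤ C) (hu : MemLp u 2 μ) :
    Integrable (fun p => w p.1 ^ 2 * ‖u p‖ ^ 2) μ := by
  simpa only [norm_ofReal_mul_sq] using
    (hu.ofReal_comp_fst_mul hw hC).integrable_norm_pow (by simp : 2 ≠ 0)

/-- Pointwise integrand of the form at `(u, w² u)`, with `s = w` and `s' = w'`. -/
theorem re_weighted_form_eq (s s' : ℝ) (z zx zy : ℂ) :
    (zx * star (((s ^ 2 : ℝ) : ℂ) * zx + ((2 * s * s' : ℝ) : ℂ) * z) +
      zy * star (((s ^ 2 : ℝ) : ℂ) * zy)).re =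
      s ^ 2 * (‖zx‖ ^ 2 + ‖zy‖ ^ 2) + 2 * s * s' * inner ℝ z zx := by
  simp only [Complex.sq_norm, Complex.normSq_apply, Complex.inner, star_add, star_mul',
    Complex.star_def, Complex.conj_ofReal, Complex.add_re, Complex.mul_re, Complex.mul_im,
    Complex.add_im, Complex.conj_re, Complex.conj_im, Complex.ofReal_re, Complex.ofReal_im]
  ring

/-- The cross term consumes all of `s²‖zx‖²`; the resulting coefficient `a²` gives the condition `a²
< 1 - λ`. -/
theorem sub_sq_mul_le_weighted_form {s s' : ℝ} (hs : |s'| ≤ a * s) (z zx zy : ℂ) :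
    s ^ 2 * ‖zy‖ ^ 2 - a ^ 2 * (s ^ 2 * ‖z‖ ^ 2) ≤
      s ^ 2 * (‖zx‖ ^ 2 + ‖zy‖ ^ 2) + 2 * s * s' * inner ℝ z zx := by
  have h1 : |s * s' * inner ℝ z zx| ≤ |s| * |s'| * (‖z‖ * ‖zx‖) := by
    rw [abs_mul, abs_mul]; gcongr; exact abs_real_inner_le_norm _ _
  have h2 := neg_le_of_abs_le h1
  have h3 : s' ^ 2 ≤ (a * s) ^ 2 := sq_le_sq.2 (hs.trans (le_abs_self _))
  have h4 := mul_le_mul_of_nonneg_right h3 (sq_nonneg ‖z‖)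
  nlinarith [sq_nonneg (|s| * ‖zx‖ - |s'| * ‖z‖), sq_abs s, sq_abs s']

/-- Here the cross term may consume only half of `s²‖zx‖²`, so that the full gradient is still
controlled, at the price of `2a²`. -/
theorem half_sub_sq_mul_le_weighted_form {s s' : ℝ} (hs : |s'| ≤ a * s) (z zx zy : ℂ) :
    1 / 2 * (s ^ 2 * ‖zx‖ ^ 2 + s ^ 2 * ‖zy‖ ^ 2) - 2 * a ^ 2 * (s ^ 2 * ‖z‖ ^ 2) ≤
      s ^ 2 * (‖zx‖ ^ 2 + ‖zy‖ ^ 2) + 2 * s * s' * inner ℝ z zx := by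
  have h1 : |s * s' * inner ℝ z zx| ≤ |s| * |s'| * (‖z‖ * ‖zx‖) := by
    rw [abs_mul, abs_mul]; gcongr; exact abs_real_inner_le_norm _ _
  have h2 := neg_le_of_abs_le h1
  have h3 : s' ^ 2 ≤ (a * s) ^ 2 := sq_le_sq.2 (hs.trans (le_abs_self _))
  have h4 := mul_le_mul_of_nonneg_right h3 (sq_nonneg ‖z‖)
  have h5 := mul_nonneg (sq_nonneg s) (sq_nonneg ‖zy‖)
  nlinarith [sq_nonneg (|s| * ‖zx‖ - 2 * |s'| * ‖z‖), sq_abs s, sq_abs s']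

/-- Testing the eigenvalue equation against `w² u`, where `w` depends on the first coordinate. -/
theorem MemFormDomain.integral_weighted_form_eq (hu : MemFormDomain Ω Γ u ux uy)
    (heq : ∀ v hx hy : ℝ × ℝ → ℂ, MemFormDomain Ω Γ v hx hy →
      ∫ p in Ω, (ux p * star (hx p) + uy p * star (hy p)) = ∫ p in Ω, lam * u p * star (v p))
    (hw : ContDiff ℝ ∞ w) (hC : ∀ x, |w x| ≤ C) (hw' : ∀ x, |deriv w x| ≤ a * w x)
    (ha : 0 ≤ a) :
    IntegrableOn (fun p => w p.1 ^ 2 * (‖ux p‖ ^ 2 + ‖uy p‖ ^ 2) +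
        2 * w p.1 * deriv w p.1 * inner ℝ (u p) (ux p)) Ω ∧
      ∫ p in Ω, (w p.1 ^ 2 * (‖ux p‖ ^ 2 + ‖uy p‖ ^ 2) +
        2 * w p.1 * deriv w p.1 * inner ℝ (u p) (ux p)) =
        lam * ∫ p in Ω, w p.1 ^ 2 * ‖u p‖ ^ 2 := by
  have hder : ∀ x, deriv (fun x => w x ^ 2) x = 2 * w x * deriv w x := fun x => by
    have := (((hw.differentiable (by simp)) x).hasDerivAt.pow 2).deriv
    simpa [Pi.pow_def] using this
  have hC2 : ∀ x, |w x ^ 2| ≤ C ^ 2 := fun x => by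
    rw [abs_pow]; gcongr; exact hC x
  -- From `(w²)' = 2 w w'` and `|w'| ≤ a w ≤ a C`.
  have hC' : ∀ x, |deriv (fun x => w x ^ 2) x| ≤ 2 * C * (a * C) := fun x => by
    have : 0 ≤ C := (abs_nonneg _).trans (hC x)
    rw [hder, abs_mul, abs_mul, abs_two]
    gcongr
    · exact hC x
    · exact (hw' x).trans (mul_le_mul_of_nonneg_left ((le_abs_self _).trans (hC x)) ha)
  have hv := hu.ofReal_comp_fst_mul (hw.pow 2) hC2 hC'
  have e := heq _ _ _ hv
  simp only [hder] at hv e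
  have hi : IntegrableOn (fun p => ux p * star (((w p.1 ^ 2 : ℝ) : ℂ) * ux p +
      ((2 * w p.1 * deriv w p.1 : ℝ) : ℂ) * u p) +
      uy p * star (((w p.1 ^ 2 : ℝ) : ℂ) * uy p)) Ω :=
    (MemLp.integrable_mul (q := 2) hu.memH1.memLp_x hv.memH1.memLp_x.star).add
      (MemLp.integrable_mul (q := 2) hu.memH1.memLp_y hv.memH1.memLp_y.star)
  have hir := hi.re
  have e1 := integral_re hi
  rw [e] at e1
  simp only [RCLike.re_to_complex, re_weighted_form_eq] at hir e1
  refine ⟨hir, e1.trans ?_⟩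
  have e2 : ∀ p, lam * u p * star (((w p.1 ^ 2 : ℝ) : ℂ) * u p) =
      ((lam * (w p.1 ^ 2 * ‖u p‖ ^ 2) : ℝ) : ℂ) := fun p => by
    have := Complex.mul_conj' (u p)
    simp only [star_mul', Complex.star_def, Complex.conj_ofReal]
    push_cast
    linear_combination (lam * (w p.1 : ℂ) ^ 2) * this
  simp only [e2]
  rw [integral_complex_ofReal, Complex.ofReal_re, integral_const_mul]

/-- Agmon's estimate on a domain which is a Dirichlet strip of width `π` on the right:
the weighted energy is bounded independently of the weight. -/
theorem MemFormDomain.integral_weighted_energy_le (hu : MemFormDomain Ω Γ u ux uy)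
    (heq : ∀ v hx hy : ℝ × ℝ → ℂ, MemFormDomain Ω Γ v hx hy →
      ∫ p in Ω, (ux p * star (hx p) + uy p * star (hy p)) = ∫ p in Ω, lam * u p * star (v p))
    (hΩm : MeasurableSet Ω) (hΩ : Ω ∩ {p | 0 < p.1} = Ioi 0 ×ˢ Ioo 0 Real.pi)
    (h0 : ∀ x > 0, (x, 0) ∈ Γ) (hπ : ∀ x > 0, (x, Real.pi) ∈ Γ)
    (hw : ContDiff ℝ ∞ w) (hC : ∀ x, |w x| ≤ C) (hw' : ∀ x, |deriv w x| ≤ a * w x)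
    (hw1 : ∀ x ≤ 0, |w x| ≤ 1) (ha : 0 ≤ a) (ha' : a ^ 2 < 1 - lam) :
    ∫ p in Ioi 0 ×ˢ Ioo 0 Real.pi, w p.1 ^ 2 * (‖u p‖ ^ 2 + (‖ux p‖ ^ 2 + ‖uy p‖ ^ 2)) ≤
      (1 + 2 * |lam + 2 * a ^ 2|) * (|lam + a ^ 2| / (1 - lam - a ^ 2) + 1) *
        ∫ p in Ω, ‖u p‖ ^ 2 := by
  set S : Set (ℝ × ℝ) := Ioi 0 ×ˢ Ioo 0 Real.pi
  have hSΩ : S ⊆ Ω := hΩ ▸ inter_subset_left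
  have hSm : MeasurableSet S := measurableSet_Ioi.prod measurableSet_Ioo
  obtain ⟨hP, eP⟩ := hu.integral_weighted_form_eq heq hw hC hw' ha
  have iu : IntegrableOn _ Ω := hu.memH1.memLp.integrable_sq_mul_norm_sq hw.continuous hC
  have ix := hu.memH1.memLp_x.integrable_sq_mul_norm_sq hw.continuous hC
  have iy := hu.memH1.memLp_y.integrable_sq_mul_norm_sq hw.continuous hC
  have ixy : IntegrableOn (fun p => w p.1 ^ 2 * ‖ux p‖ ^ 2 + w p.1 ^ 2 * ‖uy p‖ ^ 2) Ω := ix.add iy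
  have b1 : (∫ p in Ω, w p.1 ^ 2 * ‖uy p‖ ^ 2) - a ^ 2 * ∫ p in Ω, w p.1 ^ 2 * ‖u p‖ ^ 2 ≤
      lam * ∫ p in Ω, w p.1 ^ 2 * ‖u p‖ ^ 2 := by
    rw [← eP, ← integral_const_mul, ← integral_sub iy (iu.const_mul _)]
    exact integral_mono (iy.sub (iu.const_mul _)) hP fun p =>
      sub_sq_mul_le_weighted_form (hw' p.1) _ _ _
  -- Bounds the weighted gradient by `2(λ + 2a²)` times the weighted mass, whence the factor `1 +
  -- 2|λ + 2a²|`.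
  have b2 : 1 / 2 * ((∫ p in Ω, w p.1 ^ 2 * ‖ux p‖ ^ 2) + ∫ p in Ω, w p.1 ^ 2 * ‖uy p‖ ^ 2) -
      2 * a ^ 2 * ∫ p in Ω, w p.1 ^ 2 * ‖u p‖ ^ 2 ≤
      lam * ∫ p in Ω, w p.1 ^ 2 * ‖u p‖ ^ 2 := by
    rw [← eP, ← integral_const_mul, ← integral_add ix iy, ← integral_const_mul,
      ← integral_sub (ixy.const_mul _) (iu.const_mul _)]
    exact integral_mono ((ixy.const_mul _).sub (iu.const_mul _)) hP fun p =>
      half_sub_sq_mul_le_weighted_form (hw' p.1) _ _ _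
  -- The strip inequality is applied to `w u`, whose second partial derivative is just `w uy`.
  have poincare : ∫ p in S, w p.1 ^ 2 * ‖u p‖ ^ 2 ≤ ∫ p in Ω, w p.1 ^ 2 * ‖uy p‖ ^ 2 := by
    have hC' : ∀ x, |deriv w x| ≤ a * C := fun x =>
      (hw' x).trans (mul_le_mul_of_nonneg_left ((le_abs_self _).trans (hC x)) ha)
    have h := (hu.ofReal_comp_fst_mul hw hC hC').integral_strip_norm_sq_le hSΩ h0 hπ
    simp only [norm_ofReal_mul_sq] at h
    exact h.trans (setIntegral_mono_set iy (.of_forall fun p => by positivity)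
      hSΩ.eventuallyLE)
  have split : ∫ p in Ω, w p.1 ^ 2 * ‖u p‖ ^ 2 =
      (∫ p in S, w p.1 ^ 2 * ‖u p‖ ^ 2) + ∫ p in Ω \ S, w p.1 ^ 2 * ‖u p‖ ^ 2 := by
    rw [← setIntegral_union disjoint_sdiff_right (hΩm.diff hSm) (iu.mono_set hSΩ)
      (iu.mono_set sdiff_subset), union_sdiff_cancel hSΩ]
  have iu0 : IntegrableOn (fun p => ‖u p‖ ^ 2) Ω :=
    hu.memH1.memLp.integrable_norm_pow (by simp : 2 ≠ 0)
  have left : ∫ p in Ω \ S, w p.1 ^ 2 * ‖u p‖ ^ 2 ≤ ∫ p in Ω, ‖u p‖ ^ 2 := by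
    refine le_trans (setIntegral_mono_on (iu.mono_set sdiff_subset) (iu0.mono_set sdiff_subset)
      (hΩm.diff hSm) fun p hp => ?_)
      (setIntegral_mono_set iu0 (.of_forall fun p => by positivity) sdiff_subset.eventuallyLE)
    have hp1 : p.1 ≤ 0 := not_lt.1 fun h => hp.2 (hΩ ▸ ⟨hp.1, h⟩)
    have : w p.1 ^ 2 ≤ 1 := (sq_le_one_iff_abs_le_one _).2 (hw1 _ hp1)
    exact mul_le_of_le_one_left (by positivity) this
  have left0 : 0 ≤ ∫ p in Ω \ S, w p.1 ^ 2 * ‖u p‖ ^ 2 :=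
    integral_nonneg fun p => by positivity
  have hM : 0 ≤ ∫ p in Ω, ‖u p‖ ^ 2 := integral_nonneg fun p => by positivity
  have hsum : ∫ p in S, w p.1 ^ 2 * (‖u p‖ ^ 2 + (‖ux p‖ ^ 2 + ‖uy p‖ ^ 2)) ≤
      (∫ p in Ω, w p.1 ^ 2 * ‖u p‖ ^ 2) + ((∫ p in Ω, w p.1 ^ 2 * ‖ux p‖ ^ 2) +
        ∫ p in Ω, w p.1 ^ 2 * ‖uy p‖ ^ 2) := by
    simp only [mul_add]
    rw [← integral_add ix iy, ← integral_add iu ixy]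
    exact setIntegral_mono_set (iu.add ixy) (.of_forall fun p => by
      simp only [Pi.zero_apply]; positivity) hSΩ.eventuallyLE
  set A := ∫ p in Ω, w p.1 ^ 2 * ‖u p‖ ^ 2
  set M := ∫ p in Ω, ‖u p‖ ^ 2
  set AS := ∫ p in S, w p.1 ^ 2 * ‖u p‖ ^ 2
  set AL := ∫ p in Ω \ S, w p.1 ^ 2 * ‖u p‖ ^ 2
  have hgap : 0 < 1 - lam - a ^ 2 := by linarith
  have hA0 : 0 ≤ A := integral_nonneg fun p => by positivity
  -- Chaining `poincare` with `b1` gives `AS ≤ (λ + a²)(AS + AL)`; the gap absorbs `AS` on the left.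
  have hAS : AS ≤ |lam + a ^ 2| / (1 - lam - a ^ 2) * M := by
    rw [div_mul_eq_mul_div, le_div_iff₀ hgap]
    have h1 : (lam + a ^ 2) * AL ≤ |lam + a ^ 2| * M :=
      mul_le_mul (le_abs_self _) left left0 (abs_nonneg _)
    rw [split] at b1
    linarith
  have hA : A ≤ (|lam + a ^ 2| / (1 - lam - a ^ 2) + 1) * M := by
    rw [split]; linarith
  have h2 : (lam + 2 * a ^ 2) * A ≤ |lam + 2 * a ^ 2| * A :=
    mul_le_mul_of_nonneg_right (le_abs_self _) hA0
  calc _ ≤ _ := hsum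
    _ ≤ (1 + 2 * |lam + 2 * a ^ 2|) * A := by linarith
    _ ≤ _ := by
      rw [mul_assoc]
      exact mul_le_mul_of_nonneg_left hA (by positivity)

/-- Exponential decay, at any rate below the gap to the transverse threshold `1`, of
eigenfunctions on a domain which is a Dirichlet strip of width `π` on the right. -/
theorem MemFormDomain.integrableOn_exp_mul_energy (hu : MemFormDomain Ω Γ u ux uy)
    (heq : ∀ v hx hy : ℝ × ℝ → ℂ, MemFormDomain Ω Γ v hx hy →
      ∫ p in Ω, (ux p * star (hx p) + uy p * star (hy p)) = ∫ p in Ω, lam * u p * star (v p))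
    (hΩm : MeasurableSet Ω) (hΩ : Ω ∩ {p | 0 < p.1} = Ioi 0 ×ˢ Ioo 0 Real.pi)
    (h0 : ∀ x > 0, (x, 0) ∈ Γ) (hπ : ∀ x > 0, (x, Real.pi) ∈ Γ)
    (ha : 0 ≤ a) (ha' : a ^ 2 < 1 - lam) :
    IntegrableOn (fun p => Real.exp (a * p.1) ^ 2 * (‖u p‖ ^ 2 + (‖ux p‖ ^ 2 + ‖uy p‖ ^ 2)))
      (Ioi 0 ×ˢ Ioo 0 Real.pi) := by
  have hSΩ : Ioi 0 ×ˢ Ioo 0 Real.pi ⊆ Ω := hΩ ▸ inter_subset_left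
  -- The weights take `δ = 1/(n+1)`. Their sup bounds `n + 1` only ensure admissibility and do not
  -- enter the final constant.
  have hδ : ∀ n : ℕ, (0 : ℝ) < 1 / ((n : ℝ) + 1) := fun n => by positivity
  have hb : ∀ (n : ℕ) x, |expWeight a (1 / ((n : ℝ) + 1)) x| ≤ (1 / ((n : ℝ) + 1))⁻¹ :=
    fun n x => (abs_of_pos (expWeight_pos (hδ n) x)).trans_le (expWeight_le_inv (hδ n) x)
  refine integrable_of_tendsto_of_integral_le
    (F := fun n p => expWeight a (1 / ((n : ℝ) + 1)) p.1 ^ 2 *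
      (‖u p‖ ^ 2 + (‖ux p‖ ^ 2 + ‖uy p‖ ^ 2))) (fun n => ?_) (fun n p => by positivity)
    (fun n => hu.integral_weighted_energy_le heq hΩm hΩ h0 hπ (contDiff_expWeight (hδ n))
      (hb n) (abs_deriv_expWeight_le ha (hδ n)) (fun x hx => ?_) ha ha')
    (fun p => ((tendsto_expWeight p.1).pow 2).mul_const _)
  · have hc := (contDiff_expWeight (a := a) (hδ n)).continuous
    simp only [mul_add]
    exact ((hu.memH1.memLp.integrable_sq_mul_norm_sq hc (hb n)).add
      ((hu.memH1.memLp_x.integrable_sq_mul_norm_sq hc (hb n)).add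
        (hu.memH1.memLp_y.integrable_sq_mul_norm_sq hc (hb n)))).mono_measure
      (Measure.restrict_mono hSΩ le_rfl)
  · rw [abs_of_pos (expWeight_pos (hδ n) x)]
    exact (expWeight_le_exp (hδ n) x).trans
      (Real.exp_le_one_iff.2 (mul_nonpos_of_nonneg_of_nonpos ha hx))

end Energy

/-! ### Geometry of the half-guide and conclusion. -/

section HalfGuide
variable {θ : ℝ}

/-- For `x ≥ 0` the slanted inequality follows from `y < π`, so its guard can be dropped and the set
becomes an intersection of open half-planes. -/
theorem halfGuide_eq (hθ : θ ∈ Ioo 0 (Real.pi / 2)) :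
    halfGuide θ = {p | -Real.pi / Real.tan θ < p.1} ∩ {p | 0 < p.2} ∩ {p | p.2 < Real.pi} ∩
      {p | p.2 < p.1 * Real.tan θ + Real.pi} := by
  have ht := Real.tan_pos_of_pos_of_lt_pi_div_two hθ.1 hθ.2
  ext p
  simp only [halfGuide, mem_ofPred_eq, mem_inter_iff]
  constructor
  · rintro ⟨h1, h2, h3, h4⟩
    refine ⟨⟨⟨h1, h2⟩, h3⟩, ?_⟩
    rcases lt_or_ge p.1 0 with h | h
    · exact h4 h
    · nlinarith [mul_nonneg h ht.le]
  · rintro ⟨⟨⟨h1, h2⟩, h3⟩, h4⟩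
    exact ⟨h1, h2, h3, fun _ => h4⟩

theorem isOpen_halfGuide (hθ : θ ∈ Ioo 0 (Real.pi / 2)) : IsOpen (halfGuide θ) := by
  rw [halfGuide_eq hθ]
  exact (((isOpen_lt (by fun_prop) (by fun_prop)).inter
    (isOpen_lt (by fun_prop) (by fun_prop))).inter
    (isOpen_lt (by fun_prop) (by fun_prop))).inter (isOpen_lt (by fun_prop) (by fun_prop))

theorem neg_pi_div_tan_neg (hθ : θ ∈ Ioo 0 (Real.pi / 2)) : -Real.pi / Real.tan θ < 0 :=
  div_neg_of_neg_of_pos (neg_neg_of_pos Real.pi_pos)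
    (Real.tan_pos_of_pos_of_lt_pi_div_two hθ.1 hθ.2)

theorem halfGuide_inter_right (hθ : θ ∈ Ioo 0 (Real.pi / 2)) :
    halfGuide θ ∩ {p | 0 < p.1} = Ioi 0 ×ˢ Ioo 0 Real.pi := by
  ext p
  simp only [halfGuide, mem_inter_iff, mem_ofPred_eq, mem_prod, mem_Ioi, mem_Ioo]
  exact ⟨fun h => ⟨h.2, h.1.2.1, h.1.2.2.1⟩, fun h => ⟨⟨(neg_pi_div_tan_neg hθ).trans h.1, h.2.1,
    h.2.2, fun h' => absurd h.1 h'.not_gt⟩, h.1⟩⟩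

end HalfGuide

theorem proposition6p1 (θ : ℝ) (hθ : θ ∈ Ioo 0 (Real.pi / 2)) (lam : ℝ) (hlam : lam < 1)
    (ψ ψx ψy : ℝ × ℝ → ℂ) (hψ : IsMixedEigenvector θ lam ψ)
    (hgrad : HasWeakGradient (halfGuide θ) ψ ψx ψy) (ε : ℝ) (hε : 0 < ε) :
    IntegrableOn
      (fun p : ℝ × ℝ => Real.exp (2 * p.1 * (Real.sqrt (1 - lam) - ε)) *
        (‖ψ p‖ ^ 2 + (‖ψx p‖ ^ 2 + ‖ψy p‖ ^ 2)))
      (Ioi 0 ×ˢ Ioo 0 Real.pi) volume := by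
  obtain ⟨-, gx, gy, hu, -, heq⟩ := hψ
  have hs : 0 < Real.sqrt (1 - lam) := Real.sqrt_pos.2 (by linarith)
  -- The maximum covers large `ε`, where the prescribed rate is negative while the estimate needs `a
  -- ≥ 0`.
  set a := max (Real.sqrt (1 - lam) - ε) 0
  have ha : 0 ≤ a := le_max_right _ _
  have ha' : a ^ 2 < 1 - lam := by
    rw [← Real.sq_sqrt (by linarith : 0 ≤ 1 - lam)]
    exact pow_lt_pow_left₀ (max_lt (by linarith) hs) ha two_ne_zero
  have hint := hu.integrableOn_exp_mul_energy heq (isOpen_halfGuide hθ).measurableSet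
    (halfGuide_inter_right hθ) (fun x hx => .inl ⟨rfl, ((neg_pi_div_tan_neg hθ).trans hx).le⟩)
    (fun x hx => .inr ⟨rfl, le_of_lt hx⟩) ha ha'
  have hSΩ : Ioi 0 ×ˢ Ioo 0 Real.pi ⊆ halfGuide θ :=
    halfGuide_inter_right hθ ▸ inter_subset_left
  obtain ⟨ex, ey⟩ := hu.memH1.weakGradient.ae_eq (isOpen_halfGuide hθ) hgrad
  have ex := ae_restrict_of_ae_restrict_of_subset hSΩ ex
  have ey := ae_restrict_of_ae_restrict_of_subset hSΩ ey
  have m0 := hu.memH1.memLp.mono_measure (Measure.restrict_mono hSΩ le_rfl)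
  have mx := (hu.memH1.memLp_x.mono_measure (Measure.restrict_mono hSΩ le_rfl)).ae_eq ex
  have my := (hu.memH1.memLp_y.mono_measure (Measure.restrict_mono hSΩ le_rfl)).ae_eq ey
  -- On `x > 0` a rate at most `a` gives a weight at most `e^{2ax}`.
  refine Integrable.mono' hint ?_ ?_
  · exact (by fun_prop : Continuous fun p : ℝ × ℝ =>
      Real.exp (2 * p.1 * (Real.sqrt (1 - lam) - ε))).aestronglyMeasurable.mul
      ((m0.1.norm.pow 2).add ((mx.1.norm.pow 2).add (my.1.norm.pow 2)))
  · filter_upwards [ex, ey, ae_restrict_mem (measurableSet_Ioi.prod measurableSet_Ioo)]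
      with p hx hy hp
    have hp1 : 0 < p.1 := hp.1
    rw [Real.norm_of_nonneg (by positivity), hx, hy, ← Real.exp_nat_mul]
    refine mul_le_mul_of_nonneg_right (Real.exp_le_exp.2 ?_) (by positivity)
    push_cast
    have : Real.sqrt (1 - lam) - ε ≤ a := le_max_left _ _
    nlinarith
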